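/- Let $n\ge 3$ and let $\mathbf{R}^n_+=\{x=(x',x_n)\in\mathbf{R}^n : x_n>0\}$, with outward unit normal $\mathbf{n}=(0,\dots,0,-1)$ on its boundary $\mathbf{R}^{n-1}\times\{0\}\cong\mathbf{R}^{n-1}$. For $s\in\mathbf{R}$, $\dot H^{s}(\mathbf{R}^{n-1})$ denotes the space of tempered distributions $g$ on $\mathbf{R}^{n-1}$ whose Fourier transform $\widehat g$ is a locally integrable function with $$\|g\|_{\dot H^{s}(\mathbf{R}^{n-1})}:=\Big(\int_{\mathbf{R}^{n-1}}|\xi'|^{2s}\,|\widehat g(\xi')|^2\,d\xi'\Big)^{1/2}<\infty ,$$ where the Fourier transform is normalised as $\widehat g(\xi')=\int e^{-2\pi i x'\cdot\xi'}g(x')\,dx'$ (another normalisation only changes the constant below). There exists a constant $C(n)>0$, depending only on $n$, such that the following holds for every (real- or complex-valued) vector field $w=(w_1,\dots,w_n)\in L^2(\mathbf{R}^n_+)^n$ with $\operatorname{div} w=0$ in $\mathbf{R}^n_+$ in the sense of distributions. There is exactly one tempered distribution $w\cdot\mathbf{n}$ on $\mathbf{R}^{n-1}$ (the normal trace of $w$)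 such that Green's formula $$\langle w\cdot\mathbf{n},\ \varphi(\cdot,0)\rangle=\int_{\mathbf{R}^n_+}\nabla\varphi\cdot w\,dx\qquad\text{for all }\varphi\in C_c^\infty(\mathbf{R}^n)$$ holds; moreover $w\cdot\mathbf{n}\in\dot H^{-1/2}(\mathbf{R}^{n-1})$ and $$\|w\cdot\mathbf{n}\|_{\dot H^{-1/2}(\mathbf{R}^{n-1})}\le C(n)\,\|w\|_{L^2(\mathbf{R}^n_+)} .$$ -/

import Mathlib

open MeasureTheory FourierTransform
open scoped ENNReal SchwartzMap Distributions

noncomputable section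

/-! Throughout, the ambient dimension is `n = d + 1`. The last coordinate is the normal one. -/

/-- The open half space `{x ∈ ℝ^(d+1) | 0 < x_{d+1}}`. -/
def halfSpace (d : ℕ) : TopologicalSpace.Opens (EuclideanSpace ℝ (Fin (d + 1))) where
  carrier := {x | 0 < x (Fin.last d)}
  is_open' := isOpen_lt continuous_const (by fun_prop)

/-- The inclusion `x' ↦ (x', 0)` of `ℝ^d` onto the boundary of the half space. -/
def boundaryPoint {d : ℕ} (y : EuclideanSpace ℝ (Fin d)) : EuclideanSpace ℝ (Fin (d + 1)) :=
  WithLp.toLp 2 (Fin.snoc (α := fun _ => ℝ) (fun i => y i) 0)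

/-- Square-integrable (complex) vector fields on the half space, with `‖w‖² = ∫ ∑ᵢ |wᵢ|²`. -/
abbrev L2Field (d : ℕ) : Type :=
  Lp (EuclideanSpace ℂ (Fin (d + 1))) 2
    (volume.restrict (halfSpace d : Set (EuclideanSpace ℝ (Fin (d + 1)))))

/-- `∫_{ℝ₊ⁿ} ∇φ · w dx = ∫_{ℝ₊ⁿ} ∑ᵢ ∂ᵢφ wᵢ dx`. -/
def gradPairing {d : ℕ} (w : L2Field d) (φ : EuclideanSpace ℝ (Fin (d + 1)) → ℂ) : ℂ :=
  ∫ x in (halfSpace d : Set (EuclideanSpace ℝ (Fin (d + 1)))),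
    ∑ i, fderiv ℝ φ x (EuclideanSpace.single i 1) * w x i

/-- `div w = 0` in the half space, in the sense of distributions. -/
def IsDivFree {d : ℕ} (w : L2Field d) : Prop :=
  ∀ φ : 𝓓(halfSpace d, ℂ), gradPairing w φ = 0

/-- The distribution `g` on `ℝ^d = ∂ℝ₊ⁿ` is the normal trace `w · n` (`n` the outward unit normal)
of the divergence-free field `w`: Green's formula
`⟨g, φ(·, 0)⟩ = ∫_{ℝ₊ⁿ} ∇φ · w dx` holds for all `φ ∈ C_c^∞(ℝⁿ)`. -/
def IsNormalTrace {d : ℕ} (w : L2Field d) (g : 𝓢'(EuclideanSpace ℝ (Fin d), ℂ)) : Prop :=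
  ∀ (φ : 𝓓((⊤ : TopologicalSpace.Opens (EuclideanSpace ℝ (Fin (d + 1)))), ℂ))
    (ψ : 𝓢(EuclideanSpace ℝ (Fin d), ℂ)),
    (∀ y, ψ y = φ (boundaryPoint y)) → g ψ = gradPairing w φ

/-- The Fourier transform of the tempered distribution `g` is the locally integrable function `G`
(as distributions, that is, when tested against `C_c^∞`). -/
def HasFourierDensity {d : ℕ} (g : 𝓢'(EuclideanSpace ℝ (Fin d), ℂ))
    (G : EuclideanSpace ℝ (Fin d) → ℂ) : Prop :=
  LocallyIntegrable G volume ∧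
    ∀ ψ : 𝓢(EuclideanSpace ℝ (Fin d), ℂ), HasCompactSupport ψ → (𝓕 g) ψ = ∫ ξ, ψ ξ * G ξ

/-- The extended homogeneous Sobolev norm `(∫ |ξ|^(2s) |ĝ(ξ)|² dξ)^(1/2)`, equal to `∞` if `ĝ` is
not a locally integrable function. A locally integrable density of `ĝ` is unique almost everywhere,
so the infimum runs over one value only. The Fourier transform is normalised as
`ĝ(ξ) = ∫ e^(-2πi x·ξ) g(x) dx`; another normalisation multiplies the norm by a constant
depending on `d` and `s` only. -/
def homSobolevENorm {d : ℕ} (s : ℝ) (g : 𝓢'(EuclideanSpace ℝ (Fin d), ℂ)) : ℝ≥0∞ :=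
  ⨅ (G : EuclideanSpace ℝ (Fin d) → ℂ) (_ : HasFourierDensity g G),
    (∫⁻ ξ, ‖ξ‖ₑ ^ (2 * s) * ‖G ξ‖ₑ ^ 2) ^ (1 / 2 : ℝ)

/-- Membership in the homogeneous Sobolev space `Ḣ^s(ℝ^d)`. -/
def MemHomSobolev {d : ℕ} (s : ℝ) (g : 𝓢'(EuclideanSpace ℝ (Fin d), ℂ)) : Prop :=
  homSobolevENorm s g < ∞

/-- The norm of `Ḣ^s(ℝ^d)` (meaningful for `g` with `MemHomSobolev s g`). -/
def homSobolevNorm {d : ℕ} (s : ℝ) (g : 𝓢'(EuclideanSpace ℝ (Fin d), ℂ)) : ℝ :=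
  (homSobolevENorm s g).toReal

end

open Filter Topology ContDiff

/-! ### Approximation of Schwartz functions by compactly supported ones -/

namespace SchwartzMap

variable {E F : Type*} [NormedAddCommGroup E] [InnerProductSpace ℝ E] [FiniteDimensional ℝ E]
  [NormedAddCommGroup F] [NormedSpace ℝ F]

/-! Green's functional `T φ = ∫ ∇φ · w` is continuous on Schwartz functions of the whole space, and
the trace is obtained by showing that `T φ` depends only on `φ(·, 0)`, with a bound in the norm dual
to `Ḣ^{-1/2}`.

Dependence on the trace alone (`gradFunctional_eq_zero`): if `φ(·, 0) = 0`, then `|φ| ≤ L|xₙ|`.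
Multiplying `φ` by a cutoff `κ(c xₙ)` produces test functions in the open half space, on which `T`
vanishes because `div w = 0`. The dangerous term `c κ'(c xₙ) φ` stays bounded as `c → ∞`, so
dominated convergence gives `T φ = 0`.

The bound (`norm_gradFunctional_le_toFreqL2`): `φ` may be replaced by any extension of its trace.
For a trace `𝓕 θ`, take the Fourier transform of `ρ⁻¹ η(τ/ρ) θ(ξ)`, where `η` is a bump of mass one
and `ρ = √(ε² + |ξ|²)`. Integrating out `τ` returns `θ`, so the trace is right; by Plancherel the
gradient energy is at most a constant times `∫ ρ |θ|²`. The parameter `ε` keeps the kernel smooth at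
`ξ = 0`, and letting `ε → 0` leaves `∫ |ξ| |θ|²`.

Duality: Hahn–Banach and Riesz in `L²(|ξ| dξ)` represent `T` by some `h`. The resulting distribution
has Fourier density `|ξ| h̄`, whose `Ḣ^{-1/2}` norm is exactly the norm of `h`. Uniqueness follows
by extending compactly supported boundary data to test functions and using density. -/

theorem exists_bound_iteratedFDeriv_one_sub_bump (χ : ContDiffBump (0 : E)) (i : ℕ) :
    ∃ C : ℝ, 0 ≤ C ∧ ∀ x, ‖iteratedFDeriv ℝ i (fun x => 1 - χ x) x‖ ≤ C := by
  obtain ⟨C, hC⟩ :=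
    (χ.contDiff (n := i)).continuous_iteratedFDeriv'.bounded_above_of_compact_support
    (χ.hasCompactSupport.iteratedFDeriv i)
  have h1 : ∃ D : ℝ, ∀ x : E, ‖iteratedFDeriv ℝ i (fun _ : E => (1 : ℝ)) x‖ ≤ D := by
    rcases i with _ | i
    · exact ⟨1, fun x => by simp⟩
    · exact ⟨0, fun x => by rw [iteratedFDeriv_const_of_ne (by simp)]; simp⟩
  obtain ⟨D, hD⟩ := h1
  refine ⟨D + C, add_nonneg ((norm_nonneg _).trans (hD 0)) ((norm_nonneg _).trans (hC 0)),
    fun x => ?_⟩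
  have : (fun x => 1 - χ x) = (fun _ : E => (1 : ℝ)) - χ := rfl
  rw [this, iteratedFDeriv_sub_apply contDiff_const.contDiffAt χ.contDiffAt]
  exact (norm_sub_le _ _).trans (add_le_add (hD x) (hC x))

/-- Every Schwartz function is a limit of compactly supported ones vanishing wherever it does. -/
theorem exists_tendsto_hasCompactSupport (f : 𝓢(E, F)) :
    ∃ u : ℕ → 𝓢(E, F), (∀ N, HasCompactSupport (u N)) ∧ (∀ N x, f x = 0 → u N x = 0) ∧
      Tendsto u atTop (𝓝 f) := by
  let χ : ContDiffBump (0 : E) := ⟨1, 2, one_pos, one_lt_two⟩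
  let c : ℕ → ℝ := fun N => 1 / (N + 1)
  have hc : ∀ N, 0 < c N := fun N => Nat.one_div_pos_of_nat
  have hc1 : ∀ N, c N ≤ 1 := fun N => by
    simp only [c]
    rw [div_le_one (by positivity)]
    simp
  let η : ℕ → E → ℝ := fun N x => 1 - χ (c N • x)
  have hχs : ∀ N, ContDiff ℝ ∞ (fun x => χ (c N • x)) := fun N =>
    χ.contDiff.comp (contDiff_const_smul _)
  have hηs : ∀ N, ContDiff ℝ ∞ (η N) := fun N => contDiff_const.sub (hχs N)
  have hsupp : ∀ N, HasCompactSupport (fun x => χ (c N • x) • f x) := fun N =>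
    (χ.hasCompactSupport.comp_smul (hc N).ne').smul_right
  let u : ℕ → 𝓢(E, F) := fun N => (hsupp N).toSchwartzMap ((hχs N).smul (f.smooth ⊤))
  have hu : ∀ N x, u N x = χ (c N • x) • f x := fun N x => rfl
  refine ⟨u, hsupp, fun N x hx => by simp [hu, hx], ?_⟩
  rw [(schwartz_withSeminorms ℝ E F).tendsto_nhds_atTop]
  rintro ⟨k, n⟩ ε hε
  choose C hC0 hC using exists_bound_iteratedFDeriv_one_sub_bump χ
  -- Each derivative of the dilated cutoff brings a factor `c N ≤ 1`, so the bounds are uniform in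
  -- `N`.
  have hηC : ∀ N i x, ‖iteratedFDeriv ℝ i (η N) x‖ ≤ C i := by
    intro N i x
    have hs : ContDiff ℝ i (fun x => 1 - χ x) := contDiff_const.sub χ.contDiff
    have := congrFun (iteratedFDeriv_comp_const_smul (c N) hs) x
    change iteratedFDeriv ℝ i (η N) x = _ at this
    rw [this, norm_smul]
    calc _ ≤ 1 * ‖iteratedFDeriv ℝ i (fun x => 1 - χ x) (c N • x)‖ := by
          gcongr
          rw [norm_pow, Real.norm_of_nonneg (hc N).le]
          exact pow_le_one₀ (hc N).le (hc1 N)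
      _ ≤ C i := by rw [one_mul]; exact hC i _
  let M : ℝ := ∑ i ∈ Finset.range (n + 1),
    (n.choose i : ℝ) * C i * SchwartzMap.seminorm ℝ (k + 1) (n - i) f
  have hM : 0 ≤ M := Finset.sum_nonneg fun i _ =>
    mul_nonneg (mul_nonneg (by positivity) (hC0 i)) (apply_nonneg _ _)
  have key : ∀ N, SchwartzMap.seminorm ℝ k n (u N - f) ≤ c N * M := by
    intro N
    refine seminorm_le_bound ℝ k n _ (mul_nonneg (hc N).le hM) fun x => ?_
    have e : ⇑(u N - f) = -(fun x => η N x • f x) := by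
      ext x
      simp [hu, η, sub_smul]
    rw [e, iteratedFDeriv_neg, Pi.neg_apply, norm_neg]
    -- Near the origin `η N` vanishes identically. Elsewhere `1 ≤ c N * ‖x‖`, so one extra power of
    -- `‖x‖`, paid for by the seminorm of order `k + 1`, gains the factor `c N`.
    by_cases hx : ‖c N • x‖ < 1
    · have h0 : (fun x => η N x • f x) =ᶠ[𝓝 x] fun _ => 0 := by
        have : ∀ᶠ y in 𝓝 x, ‖c N • y‖ < 1 :=
          (continuous_const_smul (c N)).norm.continuousAt.eventually (gt_mem_nhds hx)
        filter_upwards [this] with y hy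
        have : χ (c N • y) = 1 := χ.one_of_mem_closedBall (by simpa using hy.le)
        simp [η, this]
      rw [(h0.iteratedFDeriv ℝ n).eq_of_nhds]
      have : iteratedFDeriv ℝ n (fun _ : E => (0 : F)) x = 0 := by
        rw [iteratedFDeriv_fun_zero]; rfl
      rw [this, norm_zero, mul_zero]
      exact mul_nonneg (hc N).le hM
    · have hx1 : 1 ≤ c N * ‖x‖ := by
        rw [norm_smul, Real.norm_of_nonneg (hc N).le] at hx
        exact not_lt.1 hx
      calc ‖x‖ ^ k * ‖iteratedFDeriv ℝ n (fun x => η N x • f x) x‖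
          ≤ ‖x‖ ^ k * ∑ i ∈ Finset.range (n + 1),
            (n.choose i : ℝ) * ‖iteratedFDeriv ℝ i (η N) x‖ * ‖iteratedFDeriv ℝ (n - i) f x‖ := by
            gcongr
            exact norm_iteratedFDeriv_smul_le (hηs N) (f.smooth ⊤) x (mod_cast le_top)
        _ ≤ (c N * ‖x‖) * (‖x‖ ^ k * ∑ i ∈ Finset.range (n + 1),
            (n.choose i : ℝ) * C i * ‖iteratedFDeriv ℝ (n - i) f x‖) := by
            have h2 : ∑ i ∈ Finset.range (n + 1),
              (n.choose i : ℝ) * ‖iteratedFDeriv ℝ i (η N) x‖ * ‖iteratedFDeriv ℝ (n - i) f x‖ ≤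
              ∑ i ∈ Finset.range (n + 1),
              (n.choose i : ℝ) * C i * ‖iteratedFDeriv ℝ (n - i) f x‖ := by
              gcongr
              exact hηC N _ x
            refine (mul_le_mul_of_nonneg_left h2 (by positivity)).trans ?_
            refine le_mul_of_one_le_left (mul_nonneg (by positivity) ?_) hx1
            exact Finset.sum_nonneg fun i _ =>
              mul_nonneg (mul_nonneg (by positivity) (hC0 i)) (norm_nonneg _)
        _ = c N * ∑ i ∈ Finset.range (n + 1),
            (n.choose i : ℝ) * C i * (‖x‖ ^ (k + 1) * ‖iteratedFDeriv ℝ (n - i) f x‖) := by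
            simp only [Finset.mul_sum]
            refine Finset.sum_congr rfl fun i _ => ?_
            ring
        _ ≤ c N * M := by
            refine mul_le_mul_of_nonneg_left (Finset.sum_le_sum fun i _ => ?_) (hc N).le
            exact mul_le_mul_of_nonneg_left (le_seminorm ℝ (k + 1) (n - i) f x)
              (mul_nonneg (by positivity) (hC0 i))
  have hlim : Tendsto (fun N => c N * M) atTop (𝓝 0) := by
    simpa [c] using (tendsto_one_div_add_atTop_nhds_zero_nat (𝕜 := ℝ)).mul_const M
  obtain ⟨N₀, hN₀⟩ := eventually_atTop.1 (hlim.eventually (gt_mem_nhds hε))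
  exact ⟨N₀, fun N hN => (key N).trans_lt (hN₀ N hN)⟩

end SchwartzMap

/-! ### Green's functional on Schwartz functions -/

noncomputable section

instance MeasureTheory.Measure.instHasTemperateGrowthRestrict {E : Type*} [NormedAddCommGroup E]
    [MeasurableSpace E] {μ : Measure E} [h : μ.HasTemperateGrowth] (s : Set E) :
    (μ.restrict s).HasTemperateGrowth :=
  let ⟨n, hn⟩ := h.exists_integrable
  ⟨n, hn.mono_measure Measure.restrict_le_self⟩

theorem SchwartzMap.norm_toLp_restrict_le {E F : Type*} [NormedAddCommGroup E] [NormedSpace ℝ E]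
    [MeasurableSpace E] [BorelSpace E] [SecondCountableTopology E] [NormedAddCommGroup F]
    [NormedSpace ℝ F] (f : 𝓢(E, F)) (p : ℝ≥0∞) (μ : Measure E) [μ.HasTemperateGrowth] (s : Set E) :
    ‖f.toLp p (μ.restrict s)‖ ≤ ‖f.toLp p μ‖ := by
  rw [norm_toLp, norm_toLp]
  exact ENNReal.toReal_mono (f.eLpNorm_lt_top p μ).ne
    (eLpNorm_mono_measure _ Measure.restrict_le_self)

/-- Cauchy–Schwarz, using that multiplication on `ℂ` has operator norm one. -/
theorem ContinuousLinearMap.norm_lpPairing_apply_apply_le {α : Type*} [MeasurableSpace α]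
    {μ : Measure α} (f g : Lp ℂ 2 μ) :
    ‖(ContinuousLinearMap.mul ℂ ℂ).lpPairing μ 2 2 f g‖ ≤ ‖f‖ * ‖g‖ := by
  have h := (L1.norm_integral_le ((ContinuousLinearMap.mul ℂ ℂ).holder 1 f g)).trans
    (ContinuousLinearMap.norm_holder_apply_apply_le _ _ _)
  rw [ContinuousLinearMap.opNorm_mul, one_mul] at h
  rw [lpPairing_eq_integral, ← integral_congr_ae (coeFn_holder (r := 1) _ f g),
    ← L1.integral_eq_integral]
  exact h

/-- The `i`-th component of a square-integrable field. -/
def L2Field.component {d : ℕ} (w : L2Field d) (i : Fin (d + 1)) :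
    Lp ℂ 2 (volume.restrict (halfSpace d : Set (EuclideanSpace ℝ (Fin (d + 1))))) :=
  (EuclideanSpace.proj i : EuclideanSpace ℂ (Fin (d + 1)) →L[ℂ] ℂ).compLp w

theorem L2Field.component_ae {d : ℕ} (w : L2Field d) (i : Fin (d + 1)) :
    w.component i =ᵐ[volume.restrict (halfSpace d : Set (EuclideanSpace ℝ (Fin (d + 1))))]
      fun x => w x i :=
  ContinuousLinearMap.coeFn_compLp _ _

theorem L2Field.norm_component_le {d : ℕ} (w : L2Field d) (i : Fin (d + 1)) :
    ‖w.component i‖ ≤ ‖w‖ := by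
  refine Lp.norm_le_norm_of_ae_le ?_
  filter_upwards [w.component_ae i] with x hx
  rw [hx]
  exact PiLp.norm_apply_le _ _

theorem L2Field.memLp_component {d : ℕ} (w : L2Field d) (i : Fin (d + 1)) :
    MemLp (fun x => w x i) 2
      (volume.restrict (halfSpace d : Set (EuclideanSpace ℝ (Fin (d + 1))))) :=
  (memLp_congr_ae (w.component_ae i)).1 (Lp.memLp _)

open LineDeriv in
/-- The partial derivative `∂ᵢ` on Schwartz functions. -/
def partialDeriv {d : ℕ} (i : Fin (d + 1)) :
    𝓢(EuclideanSpace ℝ (Fin (d + 1)), ℂ) →L[ℂ] 𝓢(EuclideanSpace ℝ (Fin (d + 1)), ℂ) :=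
  lineDerivOpCLM ℂ _ (EuclideanSpace.single i (1 : ℝ))

theorem partialDeriv_apply {d : ℕ} (i : Fin (d + 1)) (φ : 𝓢(EuclideanSpace ℝ (Fin (d + 1)), ℂ))
    (x : EuclideanSpace ℝ (Fin (d + 1))) :
    partialDeriv i φ x = fderiv ℝ φ x (EuclideanSpace.single i 1) := rfl

/-- The functional `φ ↦ ∫ ∇φ · w` as a tempered distribution. -/
def gradFunctional {d : ℕ} (w : L2Field d) : 𝓢(EuclideanSpace ℝ (Fin (d + 1)), ℂ) →L[ℂ] ℂ :=
  ∑ i, ((ContinuousLinearMap.mul ℂ ℂ).lpPairing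
    (volume.restrict (halfSpace d : Set (EuclideanSpace ℝ (Fin (d + 1))))) 2 2
      (w.component i)) ∘L SchwartzMap.toLpCLM ℂ ℂ 2 _ ∘L partialDeriv i

theorem gradFunctional_eq_sum {d : ℕ} (w : L2Field d)
    (φ : 𝓢(EuclideanSpace ℝ (Fin (d + 1)), ℂ)) :
    gradFunctional w φ = ∑ i, (ContinuousLinearMap.mul ℂ ℂ).lpPairing
      (volume.restrict (halfSpace d : Set (EuclideanSpace ℝ (Fin (d + 1))))) 2 2
      (w.component i) ((partialDeriv i φ).toLp 2 _) := by
  simp [gradFunctional]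

theorem gradFunctional_apply {d : ℕ} (w : L2Field d)
    (φ : 𝓢(EuclideanSpace ℝ (Fin (d + 1)), ℂ)) : gradFunctional w φ = gradPairing w φ := by
  simp only [gradFunctional_eq_sum, gradPairing, ContinuousLinearMap.lpPairing_eq_integral]
  rw [integral_finsetSum]
  · refine Finset.sum_congr rfl fun i _ => integral_congr_ae ?_
    filter_upwards [w.component_ae i, SchwartzMap.coeFn_toLp (partialDeriv i φ) 2
      (volume.restrict (halfSpace d : Set (EuclideanSpace ℝ (Fin (d + 1)))))] with x h1 h2
    rw [h1, h2, partialDeriv_apply]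
    exact mul_comm _ _
  · intro i _
    exact ((partialDeriv i φ).memLp 2
      (volume.restrict (halfSpace d : Set (EuclideanSpace ℝ (Fin (d + 1)))))).integrable_mul
      (w.memLp_component i)

/-- Cauchy–Schwarz in each component separately. The derivatives are measured on the whole space so
that Plancherel applies; the sum over `i` is the source of the factor `d + 1` in `traceConst`. -/
theorem norm_gradFunctional_le {d : ℕ} (w : L2Field d)
    (φ : 𝓢(EuclideanSpace ℝ (Fin (d + 1)), ℂ)) :
    ‖gradFunctional w φ‖ ≤ ‖w‖ * ∑ i, ‖(partialDeriv i φ).toLp 2‖ := by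
  rw [gradFunctional_eq_sum, Finset.mul_sum]
  refine norm_sum_le_of_le _ fun i _ => ?_
  refine (ContinuousLinearMap.norm_lpPairing_apply_apply_le _ _).trans ?_
  exact mul_le_mul (w.norm_component_le i) ((partialDeriv i φ).norm_toLp_restrict_le _ _ _)
    (norm_nonneg _) (norm_nonneg _)

/-! ### Boundary embedding, trace and tangential coordinates -/

/-- The inclusion of the boundary as a linear isometry. -/
def boundaryEmbedding (d : ℕ) :
    EuclideanSpace ℝ (Fin d) →ₗᵢ[ℝ] EuclideanSpace ℝ (Fin (d + 1)) where
  toFun := boundaryPoint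
  map_add' x y := by
    ext i
    refine Fin.lastCases ?_ (fun i => ?_) i <;> simp [boundaryPoint]
  map_smul' c x := by
    ext i
    refine Fin.lastCases ?_ (fun i => ?_) i <;> simp [boundaryPoint]
  norm_map' x := by
    simp [boundaryPoint, EuclideanSpace.norm_eq, Fin.sum_univ_castSucc]

/-- Restriction of Schwartz functions to the boundary. -/
def boundaryTrace (d : ℕ) :
    𝓢(EuclideanSpace ℝ (Fin (d + 1)), ℂ) →L[ℂ] 𝓢(EuclideanSpace ℝ (Fin d), ℂ) :=
  SchwartzMap.compCLMOfAntilipschitz ℂ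
    (boundaryEmbedding d).toContinuousLinearMap.hasTemperateGrowth
    (boundaryEmbedding d).isometry.antilipschitz

theorem boundaryTrace_apply {d : ℕ} (φ : 𝓢(EuclideanSpace ℝ (Fin (d + 1)), ℂ))
    (y : EuclideanSpace ℝ (Fin d)) : boundaryTrace d φ y = φ (boundaryPoint y) := rfl

/-- The tangential part `x'` of `x = (x', xₙ)`. -/
def tangentialPart (d : ℕ) : EuclideanSpace ℝ (Fin (d + 1)) →L[ℝ] EuclideanSpace ℝ (Fin d) :=
  LinearMap.toContinuousLinearMap
    { toFun := fun x => WithLp.toLp 2 fun i : Fin d => x i.castSucc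
      map_add' := fun _ _ => rfl
      map_smul' := fun _ _ => rfl }

theorem tangentialPart_apply {d : ℕ} (x : EuclideanSpace ℝ (Fin (d + 1))) (i : Fin d) :
    tangentialPart d x i = x i.castSucc := rfl

theorem tangentialPart_boundaryPoint {d : ℕ} (y : EuclideanSpace ℝ (Fin d)) :
    tangentialPart d (boundaryPoint y) = y := by
  ext i
  simp [tangentialPart_apply, boundaryPoint]

theorem boundaryPoint_last {d : ℕ} (y : EuclideanSpace ℝ (Fin d)) :
    boundaryPoint y (Fin.last d) = 0 := by
  simp [boundaryPoint]

theorem norm_sq_eq_tangentialPart {d : ℕ} (x : EuclideanSpace ℝ (Fin (d + 1))) :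
    ‖x‖ ^ 2 = ‖tangentialPart d x‖ ^ 2 + x (Fin.last d) ^ 2 := by
  simp [EuclideanSpace.norm_sq_eq, Fin.sum_univ_castSucc, tangentialPart_apply]

theorem norm_sub_boundaryPoint {d : ℕ} (x : EuclideanSpace ℝ (Fin (d + 1))) :
    ‖x - boundaryPoint (tangentialPart d x)‖ = |x (Fin.last d)| := by
  rw [← sq_eq_sq₀ (norm_nonneg _) (abs_nonneg _), norm_sq_eq_tangentialPart, map_sub,
    tangentialPart_boundaryPoint]
  simp [boundaryPoint_last]

theorem hasCompactSupport_of_tangentialPart_le {d : ℕ} {F : Type*} [Zero F]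
    {f : EuclideanSpace ℝ (Fin (d + 1)) → F} (R S : ℝ)
    (h : ∀ x, f x ≠ 0 → ‖tangentialPart d x‖ ≤ R ∧ |x (Fin.last d)| ≤ S) :
    HasCompactSupport f := by
  refine HasCompactSupport.intro
    (isCompact_closedBall (0 : EuclideanSpace ℝ (Fin (d + 1))) (R + S)) fun x hx => ?_
  by_contra h0
  obtain ⟨h1, h2⟩ := h x h0
  refine hx (mem_closedBall_zero_iff.2 (abs_le_of_sq_le_sq' ?_ ?_).2)
  · rw [norm_sq_eq_tangentialPart, ← sq_abs (x _)]
    nlinarith [norm_nonneg (tangentialPart d x), abs_nonneg (x (Fin.last d))]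
  · linarith [norm_nonneg (tangentialPart d x), abs_nonneg (x (Fin.last d))]

/-! ### Uniqueness of the normal trace -/

/-- Normal traces are unique. -/
theorem IsNormalTrace.unique {d : ℕ} {w : L2Field d} {g₁ g₂ : 𝓢'(EuclideanSpace ℝ (Fin d), ℂ)}
    (h₁ : IsNormalTrace w g₁) (h₂ : IsNormalTrace w g₂) : g₁ = g₂ := by
  have hc : ∀ ψ : 𝓢(EuclideanSpace ℝ (Fin d), ℂ), HasCompactSupport ψ → g₁ ψ = g₂ ψ := by
    intro ψ hψ
    let χ : ContDiffBump (0 : ℝ) := ⟨1, 2, one_pos, one_lt_two⟩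
    obtain ⟨R, hR⟩ := hψ.isBounded.exists_norm_le
    -- The product extension `χ(xₙ) ψ(x')`, with trace `ψ` because `χ(0) = 1`.
    let φ : 𝓓((⊤ : TopologicalSpace.Opens (EuclideanSpace ℝ (Fin (d + 1)))), ℂ) :=
      { toFun := fun x => χ (x (Fin.last d)) • ψ (tangentialPart d x)
        contDiff' := by
          have h : ContDiff ℝ ∞ fun x : EuclideanSpace ℝ (Fin (d + 1)) => χ (x (Fin.last d)) :=
            χ.contDiff.comp (EuclideanSpace.proj (𝕜 := ℝ) (Fin.last d)).contDiff
          exact h.smul ((ψ.smooth ⊤).comp (tangentialPart d).contDiff)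
        hasCompactSupport' := by
          refine hasCompactSupport_of_tangentialPart_le R 2 fun x hx => ⟨?_, ?_⟩
          · exact hR _ (subset_tsupport _ fun h => hx (by simp [h]))
          · by_contra h
            refine hx ?_
            rw [χ.zero_of_le_dist (by simpa using (not_le.1 h).le), zero_smul]
        tsupport_subset' := fun _ _ => trivial }
    have hφ : ∀ y, ψ y = φ (boundaryPoint y) := by
      intro y
      change ψ y = χ (boundaryPoint y (Fin.last d)) • ψ (tangentialPart d (boundaryPoint y))
      rw [boundaryPoint_last, tangentialPart_boundaryPoint, χ.eventuallyEq_one.eq_of_nhds,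
        Pi.one_apply, one_smul]
    rw [h₁ φ ψ hφ, h₂ φ ψ hφ]
  ext f
  obtain ⟨u, hu, -, hlim⟩ := SchwartzMap.exists_tendsto_hasCompactSupport f
  refine tendsto_nhds_unique ((map_continuous g₁).tendsto f |>.comp hlim) ?_
  refine ((map_continuous g₂).tendsto f |>.comp hlim).congr fun N => ?_
  exact (hc _ (hu N)).symm

/-! ### Green's functional vanishes on functions with zero trace -/

/-- A smooth function vanishing for `s ≤ 1` and equal to `1` for `s ≥ 2`. -/
def unitTransition (s : ℝ) : ℝ := Real.smoothTransition (s - 1)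

theorem contDiff_unitTransition : ContDiff ℝ ∞ unitTransition :=
  Real.smoothTransition.contDiff.comp (contDiff_id.sub contDiff_const)

theorem unitTransition_of_le {s : ℝ} (h : s ≤ 1) : unitTransition s = 0 :=
  Real.smoothTransition.zero_of_nonpos (by linarith)

theorem unitTransition_of_ge {s : ℝ} (h : 2 ≤ s) : unitTransition s = 1 :=
  Real.smoothTransition.one_of_one_le (by linarith)

/-- The derivative lives on the compact interval `[1, 2]`. The quantity `κ'(s) s` is what remains of
`c κ'(c t) t` after setting `s = c t`, so the bound does not depend on the dilation `c`. -/
theorem exists_abs_deriv_unitTransition_mul_le :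
    ∃ M : ℝ, 0 ≤ M ∧ ∀ s, |deriv unitTransition s * s| ≤ M := by
  have hc : Continuous fun s => deriv unitTransition s * s :=
    (contDiff_unitTransition.continuous_deriv (by simp)).mul continuous_id
  obtain ⟨M, hM⟩ := (isCompact_Icc (a := (1 : ℝ)) (b := 2)).exists_bound_of_continuousOn
    hc.continuousOn
  have hM0 : 0 ≤ M := (norm_nonneg _).trans (hM 1 (by simp))
  refine ⟨M, hM0, fun s => ?_⟩
  rcases lt_or_ge s 1 with h | h
  · have : unitTransition =ᶠ[𝓝 s] fun _ => 0 := by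
      filter_upwards [gt_mem_nhds h] with t ht using unitTransition_of_le ht.le
    simpa [this.deriv_eq] using hM0
  rcases lt_or_ge 2 s with h' | h'
  · have : unitTransition =ᶠ[𝓝 s] fun _ => 1 := by
      filter_upwards [lt_mem_nhds h'] with t ht using unitTransition_of_ge ht.le
    simpa [this.deriv_eq] using hM0
  · exact hM s ⟨h, h'⟩

/-- Mean value inequality between `x` and its foot on the boundary, where `φ` is zero. -/
theorem exists_norm_le_of_boundaryTrace_eq_zero {d : ℕ}
    {φ : 𝓢(EuclideanSpace ℝ (Fin (d + 1)), ℂ)} (h : boundaryTrace d φ = 0) :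
    ∃ L : ℝ, 0 ≤ L ∧ ∀ x, ‖φ x‖ ≤ L * |x (Fin.last d)| := by
  refine ⟨SchwartzMap.seminorm ℝ 0 0 (SchwartzMap.fderivCLM ℝ _ ℂ φ), apply_nonneg _ _,
    fun x => ?_⟩
  have h0 : φ (boundaryPoint (tangentialPart d x)) = 0 := by
    rw [← boundaryTrace_apply, h]; rfl
  have := convex_univ.norm_image_sub_le_of_norm_fderiv_le (𝕜 := ℝ) (f := φ)
    (fun y _ => φ.differentiableAt)
    (fun y _ => (SchwartzMap.fderivCLM ℝ _ ℂ φ).norm_le_seminorm ℝ y)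
    (Set.mem_univ (boundaryPoint (tangentialPart d x))) (Set.mem_univ x)
  rwa [h0, sub_zero, norm_sub_boundaryPoint] at this

/-- The cutoff `x ↦ unitTransition (c xₙ)`, vanishing near the boundary. -/
def normalCutoff (d : ℕ) (c : ℝ) (x : EuclideanSpace ℝ (Fin (d + 1))) : ℝ :=
  unitTransition (c * x (Fin.last d))

theorem contDiff_normalCutoff (d : ℕ) (c : ℝ) : ContDiff ℝ ∞ (normalCutoff d c) :=
  contDiff_unitTransition.comp
    (contDiff_const.mul (EuclideanSpace.proj (𝕜 := ℝ) (Fin.last d)).contDiff)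

theorem fderiv_normalCutoff_smul {d : ℕ} (c : ℝ) {φ : EuclideanSpace ℝ (Fin (d + 1)) → ℂ}
    {x : EuclideanSpace ℝ (Fin (d + 1))} (hφ : DifferentiableAt ℝ φ x)
    (v : EuclideanSpace ℝ (Fin (d + 1))) :
    fderiv ℝ (fun x => normalCutoff d c x • φ x) x v = normalCutoff d c x • fderiv ℝ φ x v +
      (deriv unitTransition (c * x (Fin.last d)) * (c * v (Fin.last d))) • φ x := by
  have h1 : HasDerivAt unitTransition _ (c * x (Fin.last d)) :=
    (contDiff_unitTransition.differentiable (by simp)).differentiableAt.hasDerivAt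
  have h2 : HasFDerivAt (fun x : EuclideanSpace ℝ (Fin (d + 1)) => c * x (Fin.last d))
      (c • (EuclideanSpace.proj (𝕜 := ℝ) (Fin.last d) : EuclideanSpace ℝ (Fin (d + 1)) →L[ℝ] ℝ))
      x :=
    (EuclideanSpace.proj (𝕜 := ℝ) (Fin.last d)).hasFDerivAt.const_mul c
  have h3 : HasFDerivAt (normalCutoff d c) _ x := h1.comp_hasFDerivAt x h2
  rw [(h3.fun_smul hφ.hasFDerivAt).fderiv]
  simp

/-- Linear vanishing of `φ` at the boundary absorbs the factor `c` from differentiating the cutoff.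
The right side is free of `c`, and the indicator makes it square integrable when `φ` has compact
support, so it can serve as a dominating function. -/
theorem norm_fderiv_normalCutoff_smul_le {d : ℕ} {L M c : ℝ}
    (hM : ∀ s, |deriv unitTransition s * s| ≤ M)
    {φ : EuclideanSpace ℝ (Fin (d + 1)) → ℂ}
    {x : EuclideanSpace ℝ (Fin (d + 1))} (hφ : DifferentiableAt ℝ φ x)
    (hL : ‖φ x‖ ≤ L * |x (Fin.last d)|) (i : Fin (d + 1)) :
    ‖fderiv ℝ (fun x => normalCutoff d c x • φ x) x (EuclideanSpace.single i 1)‖ ≤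
      ‖fderiv ℝ φ x (EuclideanSpace.single i 1)‖ +
        (tsupport φ).indicator (fun _ => M * |L|) x := by
  rw [fderiv_normalCutoff_smul c hφ]
  have hM0 : 0 ≤ M := (abs_nonneg _).trans (hM 0)
  have hv : |(EuclideanSpace.single i 1 : EuclideanSpace ℝ (Fin (d + 1))) (Fin.last d)| ≤ 1 := by
    by_cases hi : Fin.last d = i <;> simp [hi]
  refine (norm_add_le _ _).trans (add_le_add ?_ ?_)
  · rw [norm_smul]
    refine mul_le_of_le_one_left (norm_nonneg _) ?_
    rw [normalCutoff, unitTransition, Real.norm_of_nonneg (Real.smoothTransition.nonneg _)]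
    exact Real.smoothTransition.le_one _
  · by_cases hx : x ∈ tsupport φ
    · rw [Set.indicator_of_mem hx, norm_smul]
      generalize (EuclideanSpace.single i 1 : EuclideanSpace ℝ (Fin (d + 1))) (Fin.last d) = v at *
      generalize x (Fin.last d) = t at *
      calc _ ≤ ‖deriv unitTransition (c * t) * (c * v)‖ * (|L| * |t|) := by
            refine mul_le_mul_of_nonneg_left (hL.trans ?_) (norm_nonneg _)
            exact mul_le_mul_of_nonneg_right (le_abs_self L) (abs_nonneg _)
        _ = |deriv unitTransition (c * t) * (c * t)| * |v| * |L| := by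
            simp only [Real.norm_eq_abs, abs_mul]
            ring
        _ ≤ M * 1 * |L| := by
            gcongr
            exact hM _
        _ = M * |L| := by ring
    · rw [Set.indicator_of_notMem hx, image_eq_zero_of_notMem_tsupport hx, smul_zero, norm_zero]

theorem tsupport_normalCutoff_smul_subset {d : ℕ} {c : ℝ} (hc : 0 < c)
    (φ : EuclideanSpace ℝ (Fin (d + 1)) → ℂ) :
    tsupport (fun x => normalCutoff d c x • φ x) ⊆
      (halfSpace d : Set (EuclideanSpace ℝ (Fin (d + 1)))) := by
  have h : tsupport (fun x => normalCutoff d c x • φ x) ⊆ {x | 1 / c ≤ x (Fin.last d)} := by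
    refine closure_minimal (fun x hx => ?_)
      (isClosed_le continuous_const (EuclideanSpace.proj (𝕜 := ℝ) (Fin.last d)).continuous)
    by_contra hlt
    refine hx ?_
    have : normalCutoff d c x = 0 := unitTransition_of_le (by
      rw [mul_comm]
      exact ((lt_div_iff₀ hc).1 (not_le.1 hlt)).le)
    simp only [this, zero_smul]
  exact fun x hx => (one_div_pos.2 hc).trans_le (h hx)

theorem normalCutoff_smul_eventuallyEq {d : ℕ} {c : ℝ} {x : EuclideanSpace ℝ (Fin (d + 1))}
    (hx : 2 < c * x (Fin.last d)) (φ : EuclideanSpace ℝ (Fin (d + 1)) → ℂ) :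
    (fun x => normalCutoff d c x • φ x) =ᶠ[𝓝 x] φ := by
  have hcont : Continuous fun y : EuclideanSpace ℝ (Fin (d + 1)) => c * y (Fin.last d) :=
    continuous_const.mul (EuclideanSpace.proj (𝕜 := ℝ) (Fin.last d)).continuous
  filter_upwards [hcont.continuousAt.eventually (lt_mem_nhds hx)] with y hy
  rw [show normalCutoff d c y = 1 from unitTransition_of_ge hy.le, one_smul]

theorem tendsto_gradPairing_normalCutoff {d : ℕ} (w : L2Field d)
    {φ : 𝓢(EuclideanSpace ℝ (Fin (d + 1)), ℂ)} (hφ : HasCompactSupport φ)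
    (h : boundaryTrace d φ = 0) :
    Tendsto (fun N : ℕ => gradPairing w fun x => normalCutoff d (N + 1) x • φ x) atTop
      (𝓝 (gradPairing w φ)) := by
  obtain ⟨L, hL, hφL⟩ := exists_norm_le_of_boundaryTrace_eq_zero h
  obtain ⟨M, hM, hκM⟩ := exists_abs_deriv_unitTransition_mul_le
  have hb : ∀ i, Integrable (fun x => (‖partialDeriv i φ x‖ +
      (tsupport φ).indicator (fun _ => M * |L|) x) * ‖w x i‖)
      (volume.restrict (halfSpace d : Set (EuclideanSpace ℝ (Fin (d + 1))))) := by
    intro i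
    refine MemLp.integrable_mul (p := 2) (q := 2) (MemLp.add ?_ ?_) (w.memLp_component i).norm
    · exact ((partialDeriv i φ).memLp 2 _).norm
    · refine memLp_indicator_const 2 (isClosed_tsupport φ).measurableSet _ (Or.inr ?_)
      exact ((Measure.restrict_apply_le _ _).trans_lt hφ.measure_lt_top).ne
  refine tendsto_integral_of_dominated_convergence _ (fun N => ?_)
    (integrable_finsetSum Finset.univ fun i _ => hb i) (fun N => ?_) ?_
  · refine Finset.aestronglyMeasurable_fun_sum _ fun i _ =>
      AEStronglyMeasurable.mul ?_ (w.memLp_component i).1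
    have hs : ContDiff ℝ ∞ fun x => normalCutoff d (N + 1) x • φ x :=
      (contDiff_normalCutoff d _).smul (φ.smooth ⊤)
    exact ((hs.continuous_fderiv (by simp)).clm_apply continuous_const).aestronglyMeasurable
  · refine Eventually.of_forall fun x => norm_sum_le_of_le _ fun i _ => ?_
    rw [norm_mul]
    exact mul_le_mul_of_nonneg_right
      (norm_fderiv_normalCutoff_smul_le hκM φ.differentiableAt (hφL x) i) (norm_nonneg _)
  · refine (ae_restrict_iff' (halfSpace d).isOpen.measurableSet).2
      (Eventually.of_forall fun x hx => ?_)
    have hx' : 0 < x (Fin.last d) := hx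
    have hev : ∀ᶠ N : ℕ in atTop, 2 < ((N : ℝ) + 1) * x (Fin.last d) := by
      have : Tendsto (fun N : ℕ => ((N : ℝ) + 1) * x (Fin.last d)) atTop atTop :=
        (tendsto_atTop_add_const_right _ _ tendsto_natCast_atTop_atTop).atTop_mul_const hx'
      exact this.eventually_gt_atTop 2
    refine tendsto_const_nhds.congr' ?_
    filter_upwards [hev] with N hN
    rw [(normalCutoff_smul_eventuallyEq hN φ).fderiv_eq]

/-- Green's functional annihilates compactly supported functions with zero trace. -/
theorem gradPairing_eq_zero_of_hasCompactSupport {d : ℕ} {w : L2Field d} (hw : IsDivFree w)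
    {φ : 𝓢(EuclideanSpace ℝ (Fin (d + 1)), ℂ)} (hφ : HasCompactSupport φ)
    (h : boundaryTrace d φ = 0) : gradPairing w φ = 0 := by
  have h0 : ∀ N : ℕ, gradPairing w (fun x => normalCutoff d (N + 1) x • φ x) = 0 := by
    intro N
    have hs : ContDiff ℝ ∞ fun x => normalCutoff d (N + 1) x • φ x :=
      (contDiff_normalCutoff d _).smul (φ.smooth ⊤)
    have hk : HasCompactSupport fun x => normalCutoff d (N + 1) x • φ x :=
      hφ.mono fun x hx h => hx (by simp only [h, smul_zero])
    have hN : (0 : ℝ) < N + 1 := by positivity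
    have ht := tsupport_normalCutoff_smul_subset hN φ
    exact hw ⟨_, hs, hk, ht⟩
  have := tendsto_gradPairing_normalCutoff w hφ h
  simp only [h0] at this
  exact tendsto_nhds_unique this tendsto_const_nhds

/-- Green's functional annihilates Schwartz functions with zero trace. -/
theorem gradFunctional_eq_zero {d : ℕ} {w : L2Field d} (hw : IsDivFree w)
    {φ : 𝓢(EuclideanSpace ℝ (Fin (d + 1)), ℂ)} (h : boundaryTrace d φ = 0) :
    gradFunctional w φ = 0 := by
  obtain ⟨u, hu, hu0, hlim⟩ := SchwartzMap.exists_tendsto_hasCompactSupport φ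
  refine tendsto_nhds_unique ((gradFunctional w).continuous.tendsto φ |>.comp hlim)
    (tendsto_const_nhds.congr fun N => ?_)
  rw [Function.comp_apply, gradFunctional_apply]
  refine (gradPairing_eq_zero_of_hasCompactSupport hw (hu N) ?_).symm
  -- The approximants vanish wherever `φ` does, so their traces are still zero.
  ext y
  exact hu0 N _ (congrArg (fun f : 𝓢(EuclideanSpace ℝ (Fin d), ℂ) => f y) h)

/-! ### The boundary trace on the Fourier side -/

/-- The measurable identification `(x', xₙ) ↦ x`. -/
def joinEquiv (d : ℕ) : EuclideanSpace ℝ (Fin d) × ℝ ≃ᵐ EuclideanSpace ℝ (Fin (d + 1)) :=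
  ((MeasurableEquiv.prodComm.trans
    ((MeasurableEquiv.refl ℝ).prodCongr (MeasurableEquiv.toLp 2 (Fin d → ℝ)).symm)).trans
      (MeasurableEquiv.piFinSuccAbove (fun _ => ℝ) (Fin.last d)).symm).trans
        (MeasurableEquiv.toLp 2 (Fin (d + 1) → ℝ))

theorem joinEquiv_apply {d : ℕ} (p : EuclideanSpace ℝ (Fin d) × ℝ) :
    joinEquiv d p = WithLp.toLp 2 ((Fin.last d).insertNth (α := fun _ => ℝ) p.2 fun i => p.1 i) :=
  rfl

theorem joinEquiv_last {d : ℕ} (ξ : EuclideanSpace ℝ (Fin d)) (τ : ℝ) :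
    joinEquiv d (ξ, τ) (Fin.last d) = τ := by
  simp [joinEquiv_apply]

theorem tangentialPart_joinEquiv {d : ℕ} (ξ : EuclideanSpace ℝ (Fin d)) (τ : ℝ) :
    tangentialPart d (joinEquiv d (ξ, τ)) = ξ := by
  ext i
  simp [tangentialPart_apply, joinEquiv_apply]

theorem measurePreserving_joinEquiv (d : ℕ) :
    MeasurePreserving (joinEquiv d) (volume.prod volume) volume := by
  have h1 : MeasurePreserving (Prod.swap : EuclideanSpace ℝ (Fin d) × ℝ → _)
    (volume.prod volume) (volume.prod volume) := Measure.measurePreserving_swap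
  have h2 := (MeasurePreserving.id (volume : Measure ℝ)).prod (PiLp.volume_preserving_ofLp (Fin d))
  have h3 := (volume_preserving_piFinSuccAbove (fun _ : Fin (d + 1) => ℝ) (Fin.last d)).symm
  exact (PiLp.volume_preserving_toLp (Fin (d + 1))).comp (h3.comp (h2.comp h1))

theorem continuous_joinEquiv (d : ℕ) : Continuous (joinEquiv d) := by
  change Continuous fun p => joinEquiv d p
  simp only [joinEquiv_apply]
  refine (PiLp.continuous_toLp 2 _).comp (continuous_pi fun i => ?_)
  refine Fin.lastCases ?_ (fun i => ?_) i
  · simpa using continuous_snd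
  · have h : Continuous fun p : EuclideanSpace ℝ (Fin d) × ℝ => p.1 i :=
      (EuclideanSpace.proj (𝕜 := ℝ) i).continuous.comp continuous_fst
    simpa using h

theorem inner_joinEquiv_boundaryPoint {d : ℕ} (ξ y : EuclideanSpace ℝ (Fin d)) (τ : ℝ) :
    inner ℝ (joinEquiv d (ξ, τ)) (boundaryPoint y) = inner ℝ ξ y := by
  have h : ∀ i : Fin d, joinEquiv d (ξ, τ) i.castSucc = ξ i := fun i => by
    rw [← tangentialPart_apply, tangentialPart_joinEquiv]
  simp [PiLp.inner_apply, Fin.sum_univ_castSucc, h, boundaryPoint]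

theorem integrable_comp_joinEquiv {d : ℕ} {F : Type*} [NormedAddCommGroup F]
    {f : EuclideanSpace ℝ (Fin (d + 1)) → F} (hf : Integrable f) :
    Integrable (fun p => f (joinEquiv d p)) (volume.prod volume) :=
  (measurePreserving_joinEquiv d).integrable_comp_of_integrable hf

theorem integral_eq_integral_joinEquiv {d : ℕ} {F : Type*} [NormedAddCommGroup F] [NormedSpace ℝ F]
    {f : EuclideanSpace ℝ (Fin (d + 1)) → F} (hf : Integrable f) :
    ∫ x, f x = ∫ ξ, ∫ τ, f (joinEquiv d (ξ, τ)) := by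
  rw [← (measurePreserving_joinEquiv d).integral_comp' f,
    integral_prod _ (integrable_comp_joinEquiv hf)]

/-- Restricting a Fourier transform to the boundary amounts to integrating out the normal
frequency. -/
theorem boundaryTrace_fourier {d : ℕ} (K : 𝓢(EuclideanSpace ℝ (Fin (d + 1)), ℂ)) :
    ⇑(boundaryTrace d (𝓕 K)) =
      𝓕 (fun ξ : EuclideanSpace ℝ (Fin d) => ∫ τ, K (joinEquiv d (ξ, τ))) := by
  ext y
  rw [boundaryTrace_apply, SchwartzMap.fourier_coe, Real.fourier_eq, Real.fourier_eq,
    integral_eq_integral_joinEquiv]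
  · refine integral_congr_ae (Eventually.of_forall fun ξ => ?_)
    simp only [inner_joinEquiv_boundaryPoint]
    simp only [Circle.smul_def]
    exact integral_const_mul _ _
  · exact (Real.fourierIntegral_convergent_iff _).2 K.integrable

theorem exists_norm_tangentialPart_le_of_hasCompactSupport {d : ℕ} {F : Type*} [Zero F]
    {f : EuclideanSpace ℝ (Fin (d + 1)) → F} (hf : HasCompactSupport f) :
    ∃ R : ℝ, ∀ x, f x ≠ 0 → ‖tangentialPart d x‖ ≤ R ∧ |x (Fin.last d)| ≤ R := by
  obtain ⟨R, hR⟩ := hf.isBounded.exists_norm_le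
  refine ⟨R, fun x hx => ?_⟩
  have h := hR x (subset_tsupport _ hx)
  have h2 := norm_sq_eq_tangentialPart x
  constructor
  · refine le_trans (abs_le_of_sq_le_sq' ?_ (norm_nonneg x)).2 h
    nlinarith [sq_nonneg (x (Fin.last d))]
  · refine le_trans (abs_le_of_sq_le_sq ?_ (norm_nonneg x)) h
    nlinarith [sq_nonneg ‖tangentialPart d x‖]

/-- The inverse Fourier transform of the trace of `𝓕 K` is `∫ K(·, τ) dτ` if `K` has compact
support; in particular it has compact support. -/
theorem hasCompactSupport_fourierInv_boundaryTrace {d : ℕ}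
    {K : 𝓢(EuclideanSpace ℝ (Fin (d + 1)), ℂ)} (hK : HasCompactSupport K) :
    HasCompactSupport
      (𝓕⁻ (boundaryTrace d (𝓕 K)) : 𝓢(EuclideanSpace ℝ (Fin d), ℂ)) := by
  obtain ⟨R, hR⟩ := exists_norm_tangentialPart_le_of_hasCompactSupport hK
  let k : EuclideanSpace ℝ (Fin d) → ℂ := fun ξ => ∫ τ, K (joinEquiv d (ξ, τ))
  -- A fixed compact range of integration gives continuity of `k`, needed for pointwise Fourier
  -- inversion.
  have hk : k = fun ξ => ∫ τ in Set.Icc (-R) R, K (joinEquiv d (ξ, τ)) := by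
    ext ξ
    refine (setIntegral_eq_integral_of_forall_compl_eq_zero fun τ hτ => ?_).symm
    by_contra h
    have := (hR _ h).2
    rw [joinEquiv_last] at this
    exact hτ (abs_le.1 this)
  have hcont : Continuous k := by
    rw [hk]
    exact continuous_parametric_integral_of_continuous (f := fun ξ τ => K (joinEquiv d (ξ, τ)))
      (K.continuous.comp (continuous_joinEquiv d)) isCompact_Icc
  have hint : Integrable k := (integrable_comp_joinEquiv K.integrable).integral_prod_left
  have hF : ⇑(boundaryTrace d (𝓕 K)) = 𝓕 k := boundaryTrace_fourier K
  have hint' : Integrable (𝓕 k) := hF ▸ (boundaryTrace d (𝓕 K)).integrable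
  have : ⇑(𝓕⁻ (boundaryTrace d (𝓕 K)) : 𝓢(EuclideanSpace ℝ (Fin d), ℂ)) = k := by
    rw [SchwartzMap.fourierInv_coe, hF]
    exact hcont.fourierInv_fourier_eq hint hint'
  rw [this]
  refine HasCompactSupport.intro (isCompact_closedBall (0 : EuclideanSpace ℝ (Fin d)) R)
    fun ξ hξ => ?_
  refine integral_eq_zero_of_ae (Eventually.of_forall fun τ => ?_)
  by_contra h
  have := (hR _ h).1
  rw [tangentialPart_joinEquiv] at this
  exact hξ (mem_closedBall_zero_iff.2 this)

/-! ### Extension into the half space and its energy -/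

/-- A smooth positive substitute for `‖ξ‖`. -/
def regNorm {d : ℕ} (ε : ℝ) (ξ : EuclideanSpace ℝ (Fin d)) : ℝ := √(ε ^ 2 + ‖ξ‖ ^ 2)

theorem regNorm_pos {d : ℕ} {ε : ℝ} (hε : 0 < ε) (ξ : EuclideanSpace ℝ (Fin d)) :
    0 < regNorm ε ξ := Real.sqrt_pos.2 (by positivity)

theorem norm_le_regNorm {d : ℕ} (ε : ℝ) (ξ : EuclideanSpace ℝ (Fin d)) : ‖ξ‖ ≤ regNorm ε ξ :=
  Real.le_sqrt_of_sq_le (by nlinarith [sq_nonneg ε])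

theorem regNorm_le {d : ℕ} {ε : ℝ} (hε : 0 < ε) (ξ : EuclideanSpace ℝ (Fin d)) :
    regNorm ε ξ ≤ ε + ‖ξ‖ :=
  Real.sqrt_le_iff.2 ⟨by positivity, by nlinarith [norm_nonneg ξ]⟩

theorem contDiff_regNorm {d : ℕ} {ε : ℝ} (hε : 0 < ε) :
    ContDiff ℝ ∞ (regNorm ε : EuclideanSpace ℝ (Fin d) → ℝ) :=
  (contDiff_const.add (contDiff_norm_sq ℝ)).sqrt fun ξ => by positivity

/-- A smooth probability density supported in `[-1, 1]`. -/
def profile : ℝ → ℝ :=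
  ContDiffBump.normed (⟨1 / 2, 1, by norm_num, by norm_num⟩ : ContDiffBump (0 : ℝ)) volume

theorem contDiff_profile : ContDiff ℝ ∞ profile := ContDiffBump.contDiff_normed _

theorem integral_profile : ∫ t, profile t = 1 := ContDiffBump.integral_normed _

theorem abs_le_of_profile_ne_zero {t : ℝ} (h : profile t ≠ 0) : |t| ≤ 1 := by
  have : t ∈ Function.support profile := h
  rw [profile, ContDiffBump.support_normed_eq] at this
  simpa using (Metric.mem_ball.1 this).le

/-- The Fourier side of the extension of `𝓕 θ` to the half space. -/
def extensionKernel {d : ℕ} (ε : ℝ) (θ : 𝓢(EuclideanSpace ℝ (Fin d), ℂ))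
    (x : EuclideanSpace ℝ (Fin (d + 1))) : ℂ :=
  ((regNorm ε (tangentialPart d x))⁻¹ *
    profile (x (Fin.last d) / regNorm ε (tangentialPart d x))) • θ (tangentialPart d x)

theorem contDiff_extensionKernel {d : ℕ} {ε : ℝ} (hε : 0 < ε)
    (θ : 𝓢(EuclideanSpace ℝ (Fin d), ℂ)) : ContDiff ℝ ∞ (extensionKernel ε θ) := by
  have h1 : ContDiff ℝ ∞ fun x : EuclideanSpace ℝ (Fin (d + 1)) =>
      regNorm ε (tangentialPart d x) :=
    (contDiff_regNorm hε).comp (tangentialPart d).contDiff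
  have h0 : ∀ x : EuclideanSpace ℝ (Fin (d + 1)), regNorm ε (tangentialPart d x) ≠ 0 :=
    fun x => (regNorm_pos hε _).ne'
  have h2 : ContDiff ℝ ∞ fun x : EuclideanSpace ℝ (Fin (d + 1)) =>
      profile (x (Fin.last d) / regNorm ε (tangentialPart d x)) :=
    contDiff_profile.comp ((EuclideanSpace.proj (𝕜 := ℝ) (Fin.last d)).contDiff.div h1 h0)
  exact ((h1.inv h0).mul h2).smul ((θ.smooth ⊤).comp (tangentialPart d).contDiff)

theorem abs_last_le_of_extensionKernel_ne_zero {d : ℕ} {ε : ℝ} (hε : 0 < ε)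
    {θ : 𝓢(EuclideanSpace ℝ (Fin d), ℂ)} {x : EuclideanSpace ℝ (Fin (d + 1))}
    (hx : extensionKernel ε θ x ≠ 0) :
    |x (Fin.last d)| ≤ regNorm ε (tangentialPart d x) := by
  have h : profile (x (Fin.last d) / regNorm ε (tangentialPart d x)) ≠ 0 := fun h =>
    hx (by simp [extensionKernel, h])
  have := abs_le_of_profile_ne_zero h
  rwa [abs_div, abs_of_pos (regNorm_pos hε _), div_le_one (regNorm_pos hε _)] at this

theorem hasCompactSupport_extensionKernel {d : ℕ} {ε : ℝ} (hε : 0 < ε)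
    {θ : 𝓢(EuclideanSpace ℝ (Fin d), ℂ)} (hθ : HasCompactSupport θ) :
    HasCompactSupport (extensionKernel ε θ) := by
  obtain ⟨R, hR⟩ := hθ.isBounded.exists_norm_le
  refine hasCompactSupport_of_tangentialPart_le R (ε + R) fun x hx => ?_
  have h : ‖tangentialPart d x‖ ≤ R :=
    hR _ (subset_tsupport _ fun h => hx (by simp [extensionKernel, h]))
  exact ⟨h, ((abs_last_le_of_extensionKernel_ne_zero hε hx).trans (regNorm_le hε _)).trans
    (by linarith)⟩

/-- `extensionKernel` as a Schwartz function. -/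
def extensionSchwartz {d : ℕ} {ε : ℝ} (hε : 0 < ε)
    {θ : 𝓢(EuclideanSpace ℝ (Fin d), ℂ)} (hθ : HasCompactSupport θ) :
    𝓢(EuclideanSpace ℝ (Fin (d + 1)), ℂ) :=
  (hasCompactSupport_extensionKernel hε hθ).toSchwartzMap (contDiff_extensionKernel hε θ)

theorem extensionSchwartz_apply {d : ℕ} {ε : ℝ} (hε : 0 < ε)
    {θ : 𝓢(EuclideanSpace ℝ (Fin d), ℂ)} (hθ : HasCompactSupport θ)
    (x : EuclideanSpace ℝ (Fin (d + 1))) :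
    extensionSchwartz hε hθ x = extensionKernel ε θ x := rfl

/-- Substituting `τ = ρ t` cancels the prefactor `ρ⁻¹` and leaves the unit mass of `profile`. -/
theorem integral_extensionKernel {d : ℕ} {ε : ℝ} (hε : 0 < ε)
    (θ : 𝓢(EuclideanSpace ℝ (Fin d), ℂ)) (ξ : EuclideanSpace ℝ (Fin d)) :
    ∫ τ, extensionKernel ε θ (joinEquiv d (ξ, τ)) = θ ξ := by
  have h0 := regNorm_pos hε ξ
  simp only [extensionKernel, joinEquiv_last, tangentialPart_joinEquiv]
  rw [integral_smul_const, integral_const_mul, Measure.integral_comp_div, integral_profile,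
    smul_eq_mul, mul_one, abs_of_pos h0, inv_mul_cancel₀ h0.ne', one_smul]

theorem boundaryTrace_fourier_extensionSchwartz {d : ℕ} {ε : ℝ} (hε : 0 < ε)
    {θ : 𝓢(EuclideanSpace ℝ (Fin d), ℂ)} (hθ : HasCompactSupport θ) :
    boundaryTrace d (𝓕 (extensionSchwartz hε hθ)) = 𝓕 θ := by
  apply DFunLike.coe_injective
  rw [boundaryTrace_fourier, SchwartzMap.fourier_coe]
  congr 1
  ext ξ
  exact integral_extensionKernel hε θ ξ

theorem SchwartzMap.norm_toLp_two_sq {E F : Type*} [NormedAddCommGroup E] [NormedSpace ℝ E]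
    [MeasurableSpace E] [BorelSpace E] [SecondCountableTopology E] [NormedAddCommGroup F]
    [NormedSpace ℝ F] (f : 𝓢(E, F)) (μ : Measure E) [μ.HasTemperateGrowth] :
    ‖f.toLp 2 μ‖ ^ 2 = ∫ x, ‖f x‖ ^ 2 ∂μ := by
  have h := f.norm_toLp' (μ := μ) two_ne_zero ENNReal.ofNat_ne_top
  rw [h, ENNReal.toReal_ofNat, ← Real.rpow_natCast, ← Real.rpow_mul]
  · norm_num
  · exact integral_nonneg fun x => by positivity

/-- Plancherel: `∂ᵢ` of a Fourier transform is the transform of multiplication by `-2πi xᵢ`. -/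
theorem norm_partialDeriv_fourier_toLp {d : ℕ} (K : 𝓢(EuclideanSpace ℝ (Fin (d + 1)), ℂ))
    (i : Fin (d + 1)) :
    ‖(partialDeriv i (𝓕 K)).toLp 2‖ ^ 2 = (2 * Real.pi) ^ 2 * ∫ x, (x i) ^ 2 * ‖K x‖ ^ 2 := by
  have h : partialDeriv i (𝓕 K) = 𝓕 (-(2 * Real.pi * Complex.I) •
      SchwartzMap.smulLeftCLM ℂ (inner ℝ · (EuclideanSpace.single i (1 : ℝ))) K) :=
    SchwartzMap.lineDerivOp_fourier_eq K _
  rw [h, SchwartzMap.norm_fourier_toL2_eq, SchwartzMap.norm_toLp_two_sq, ← integral_const_mul]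
  refine integral_congr_ae (Eventually.of_forall fun x => ?_)
  have hg : (fun x : EuclideanSpace ℝ (Fin (d + 1)) =>
    inner ℝ x (EuclideanSpace.single i (1 : ℝ))).HasTemperateGrowth := by fun_prop
  have hs : SchwartzMap.smulLeftCLM ℂ (fun x : EuclideanSpace ℝ (Fin (d + 1)) =>
      inner ℝ x (EuclideanSpace.single i (1 : ℝ))) K x = x i • K x := by
    rw [SchwartzMap.smulLeftCLM_apply_apply hg]
    simp [EuclideanSpace.inner_single_right]
  change ‖-(2 * Real.pi * Complex.I) • SchwartzMap.smulLeftCLM ℂ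
    (fun x : EuclideanSpace ℝ (Fin (d + 1)) =>
      inner ℝ x (EuclideanSpace.single i (1 : ℝ))) K x‖ ^ 2 = _
  rw [hs]
  simp [mul_pow]

theorem SchwartzMap.integrable_mul_norm_sq {E F : Type*} [NormedAddCommGroup E] [NormedSpace ℝ E]
    [MeasurableSpace E] [BorelSpace E] [NormedAddCommGroup F] [NormedSpace ℝ F] {f : 𝓢(E, F)}
    (hf : HasCompactSupport f) {g : E → ℝ} (hg : Continuous g) (μ : Measure E)
    [IsFiniteMeasureOnCompacts μ] : Integrable (fun x => g x * ‖f x‖ ^ 2) μ := by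
  refine (hg.mul (f.continuous.norm.pow 2)).integrable_of_hasCompactSupport
    (hf.mono fun x hx h => hx ?_)
  simp [h]

/-- On the support of the kernel `|τ| ≤ ρ`, and always `|ξ| ≤ ρ`; hence `xᵢ² ≤ |ξ|² + τ² ≤ 2ρ²`, for
normal and tangential directions alike. -/
theorem integral_sq_mul_extensionSchwartz_le {d : ℕ} {ε : ℝ} (hε : 0 < ε)
    {θ : 𝓢(EuclideanSpace ℝ (Fin d), ℂ)} (hθ : HasCompactSupport θ) (i : Fin (d + 1)) :
    ∫ x, (x i) ^ 2 * ‖extensionSchwartz hε hθ x‖ ^ 2 ≤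
      ∫ x, 2 * regNorm ε (tangentialPart d x) ^ 2 * ‖extensionSchwartz hε hθ x‖ ^ 2 := by
  have hKc : HasCompactSupport (extensionSchwartz hε hθ) := hasCompactSupport_extensionKernel hε hθ
  have hreg : Continuous fun x : EuclideanSpace ℝ (Fin (d + 1)) =>
      regNorm ε (tangentialPart d x) :=
    (contDiff_regNorm hε).continuous.comp (tangentialPart d).continuous
  refine integral_mono (SchwartzMap.integrable_mul_norm_sq hKc
      ((EuclideanSpace.proj (𝕜 := ℝ) i).continuous.pow 2) volume)
    (SchwartzMap.integrable_mul_norm_sq hKc (continuous_const.mul (hreg.pow 2)) volume) fun x => ?_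
  by_cases hx : extensionSchwartz hε hθ x = 0
  · simp [hx]
  refine mul_le_mul_of_nonneg_right ?_ (by positivity)
  change (x i) ^ 2 ≤ _
  have h1 : (x i) ^ 2 ≤ ‖x‖ ^ 2 := by
    rw [← sq_abs (x i)]
    exact pow_le_pow_left₀ (abs_nonneg _) (PiLp.norm_apply_le x i) 2
  have h2 := abs_last_le_of_extensionKernel_ne_zero hε hx
  have h3 := norm_le_regNorm ε (tangentialPart d x)
  rw [norm_sq_eq_tangentialPart] at h1
  have h4 := pow_le_pow_left₀ (norm_nonneg _) h3 2
  have h5 := pow_le_pow_left₀ (abs_nonneg _) h2 2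
  rw [sq_abs] at h5
  linarith

/-- The weight `ρ²` cancels the squared prefactor `ρ⁻²`, and `τ = ρ t` leaves a single power of `ρ`:
this is the half derivative lost by the trace. -/
theorem integral_regNorm_sq_mul_extensionSchwartz {d : ℕ} {ε : ℝ} (hε : 0 < ε)
    {θ : 𝓢(EuclideanSpace ℝ (Fin d), ℂ)} (hθ : HasCompactSupport θ) :
    ∫ x, 2 * regNorm ε (tangentialPart d x) ^ 2 * ‖extensionSchwartz hε hθ x‖ ^ 2 =
      (2 * ∫ t, profile t ^ 2) * ∫ ξ, regNorm ε ξ * ‖θ ξ‖ ^ 2 := by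
  have hKc : HasCompactSupport (extensionSchwartz hε hθ) := hasCompactSupport_extensionKernel hε hθ
  have hreg : Continuous fun x : EuclideanSpace ℝ (Fin (d + 1)) =>
      regNorm ε (tangentialPart d x) :=
    (contDiff_regNorm hε).continuous.comp (tangentialPart d).continuous
  have hc : Continuous fun x : EuclideanSpace ℝ (Fin (d + 1)) =>
      2 * regNorm ε (tangentialPart d x) ^ 2 := continuous_const.mul (hreg.pow 2)
  rw [integral_eq_integral_joinEquiv (SchwartzMap.integrable_mul_norm_sq hKc hc volume),
    ← integral_const_mul]
  refine integral_congr_ae (Eventually.of_forall fun ξ => ?_)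
  have h0 := regNorm_pos hε ξ
  have h : ∀ τ, 2 * regNorm ε (tangentialPart d (joinEquiv d (ξ, τ))) ^ 2 *
      ‖extensionSchwartz hε hθ (joinEquiv d (ξ, τ))‖ ^ 2 =
        (2 * regNorm ε ξ ^ 2 * (regNorm ε ξ)⁻¹ ^ 2 * ‖θ ξ‖ ^ 2) *
          (profile (τ / regNorm ε ξ)) ^ 2 := by
    intro τ
    simp only [extensionSchwartz_apply, extensionKernel, joinEquiv_last, tangentialPart_joinEquiv,
      norm_smul, norm_mul, mul_pow, Real.norm_eq_abs, sq_abs]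
    ring
  simp only [h]
  rw [integral_const_mul, Measure.integral_comp_div (fun t => profile t ^ 2), smul_eq_mul,
    abs_of_pos h0]
  field_simp

/-- The energy of the extension. -/
theorem norm_partialDeriv_fourier_extensionSchwartz_sq_le {d : ℕ} {ε : ℝ} (hε : 0 < ε)
    {θ : 𝓢(EuclideanSpace ℝ (Fin d), ℂ)} (hθ : HasCompactSupport θ) (i : Fin (d + 1)) :
    ‖(partialDeriv i (𝓕 (extensionSchwartz hε hθ))).toLp 2‖ ^ 2 ≤
      (2 * Real.pi) ^ 2 * ((2 * ∫ t, profile t ^ 2) *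
        (ε * (∫ ξ, ‖θ ξ‖ ^ 2) + ∫ ξ, ‖ξ‖ * ‖θ ξ‖ ^ 2)) := by
  rw [norm_partialDeriv_fourier_toLp]
  refine mul_le_mul_of_nonneg_left ((integral_sq_mul_extensionSchwartz_le hε hθ i).trans ?_)
    (by positivity)
  rw [integral_regNorm_sq_mul_extensionSchwartz hε hθ]
  have hp : 0 ≤ ∫ t, profile t ^ 2 := integral_nonneg fun t => sq_nonneg _
  refine mul_le_mul_of_nonneg_left ?_ (by positivity)
  have h2 : Integrable fun ξ => ε * ‖θ ξ‖ ^ 2 :=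
    SchwartzMap.integrable_mul_norm_sq hθ continuous_const volume
  have h3 : Integrable fun ξ => ‖ξ‖ * ‖θ ξ‖ ^ 2 :=
    SchwartzMap.integrable_mul_norm_sq hθ continuous_norm volume
  rw [← integral_const_mul, ← integral_add h2 h3]
  refine integral_mono (SchwartzMap.integrable_mul_norm_sq hθ (contDiff_regNorm hε).continuous _)
    (h2.add h3) fun ξ => ?_
  change _ ≤ ε * ‖θ ξ‖ ^ 2 + ‖ξ‖ * ‖θ ξ‖ ^ 2
  rw [← add_mul]
  exact mul_le_mul_of_nonneg_right (regNorm_le hε ξ) (sq_nonneg _)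

/-! ### The weighted frequency space and the trace inequality -/

/-- The measure `‖ξ‖ dξ`. -/
def freqMeasure (d : ℕ) : Measure (EuclideanSpace ℝ (Fin d)) :=
  volume.withDensity fun ξ => (‖ξ‖₊ : ℝ≥0∞)

instance (d : ℕ) : IsLocallyFiniteMeasure (freqMeasure d) :=
  IsLocallyFiniteMeasure.withDensity_coe continuous_nnnorm

instance (d : ℕ) : (freqMeasure d).HasTemperateGrowth := by
  -- One power more than the `d + 1` used for Lebesgue measure, to absorb the linear weight.
  refine ⟨d + 2, ?_⟩
  rw [freqMeasure, integrable_withDensity_iff_integrable_smul measurable_nnnorm]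
  have h : Integrable fun ξ : EuclideanSpace ℝ (Fin d) => (1 + ‖ξ‖) ^ (-(d + 1 : ℝ)) :=
    integrable_one_add_norm (by simp)
  refine h.mono' ?_ (Eventually.of_forall fun ξ => ?_)
  · refine Continuous.aestronglyMeasurable (continuous_nnnorm.smul ?_)
    exact (continuous_const.add continuous_norm).rpow_const fun ξ => Or.inl
      (add_pos_of_pos_of_nonneg one_pos (norm_nonneg ξ)).ne'
  · have h1 : (0 : ℝ) < 1 + ‖ξ‖ := by positivity
    rw [NNReal.smul_def, smul_eq_mul, coe_nnnorm, Real.norm_of_nonneg (by positivity)]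
    calc ‖ξ‖ * (1 + ‖ξ‖) ^ (-((d + 2 : ℕ) : ℝ))
        ≤ (1 + ‖ξ‖) * (1 + ‖ξ‖) ^ (-((d + 2 : ℕ) : ℝ)) := by
          gcongr
          linarith
      _ = (1 + ‖ξ‖) ^ (-(d + 1 : ℝ)) := by
          rw [← Real.rpow_one_add' h1.le]
          · congr 1
            push_cast
            ring
          · push_cast
            have : (0 : ℝ) ≤ d := d.cast_nonneg
            linarith

theorem integral_freqMeasure {d : ℕ} {F : Type*} [NormedAddCommGroup F] [NormedSpace ℝ F]
    (f : EuclideanSpace ℝ (Fin d) → F) : ∫ ξ, f ξ ∂freqMeasure d = ∫ ξ, ‖ξ‖ • f ξ := by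
  rw [freqMeasure, integral_withDensity_eq_integral_smul measurable_nnnorm]
  rfl

theorem integrableOn_freqMeasure_iff {d : ℕ} {F : Type*} [NormedAddCommGroup F] [NormedSpace ℝ F]
    {f : EuclideanSpace ℝ (Fin d) → F} {s : Set (EuclideanSpace ℝ (Fin d))}
    (hs : MeasurableSet s) :
    IntegrableOn f s (freqMeasure d) ↔ IntegrableOn (fun ξ => ‖ξ‖ • f ξ) s := by
  rw [IntegrableOn, freqMeasure, restrict_withDensity hs,
    integrable_withDensity_iff_integrable_smul measurable_nnnorm]
  rfl

theorem lintegral_freqMeasure {d : ℕ} {f : EuclideanSpace ℝ (Fin d) → ℝ≥0∞} (hf : Measurable f) :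
    ∫⁻ ξ, f ξ ∂freqMeasure d = ∫⁻ ξ, ‖ξ‖ₑ * f ξ :=
  lintegral_withDensity_eq_lintegral_mul _ measurable_enorm hf

/-- The map `f ↦ 𝓕⁻ f ∈ L²(‖ξ‖ dξ)`. -/
def toFreqL2 (d : ℕ) : 𝓢(EuclideanSpace ℝ (Fin d), ℂ) →L[ℂ] Lp ℂ 2 (freqMeasure d) :=
  SchwartzMap.toLpCLM ℂ ℂ 2 (freqMeasure d) ∘L fourierInvCLM ℂ 𝓢(EuclideanSpace ℝ (Fin d), ℂ)

theorem toFreqL2_apply {d : ℕ} (f : 𝓢(EuclideanSpace ℝ (Fin d), ℂ)) :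
    toFreqL2 d f = (𝓕⁻ f).toLp 2 (freqMeasure d) := rfl

/-- The constant of the trace inequality. -/
def traceConst (d : ℕ) : ℝ := (d + 1) * √((2 * Real.pi) ^ 2 * (2 * ∫ t, profile t ^ 2))

theorem traceConst_nonneg (d : ℕ) : 0 ≤ traceConst d := by
  unfold traceConst; positivity

theorem norm_gradFunctional_fourier_le {d : ℕ} {w : L2Field d} (hw : IsDivFree w)
    {K : 𝓢(EuclideanSpace ℝ (Fin (d + 1)), ℂ)} (hK : HasCompactSupport K) :
    ‖gradFunctional w (𝓕 K)‖ ≤ traceConst d * ‖w‖ * ‖toFreqL2 d (boundaryTrace d (𝓕 K))‖ := by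
  set θ : 𝓢(EuclideanSpace ℝ (Fin d), ℂ) := 𝓕⁻ (boundaryTrace d (𝓕 K)) with hθd
  have hθ : HasCompactSupport θ := hasCompactSupport_fourierInv_boundaryTrace hK
  have hFθ : 𝓕 θ = boundaryTrace d (𝓕 K) := FourierTransform.fourier_fourierInv_eq _
  have hnorm : ‖toFreqL2 d (boundaryTrace d (𝓕 K))‖ = √(∫ ξ, ‖ξ‖ * ‖θ ξ‖ ^ 2) := by
    rw [toFreqL2_apply, ← hθd, ← Real.sqrt_sq (norm_nonneg _), SchwartzMap.norm_toLp_two_sq,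
      integral_freqMeasure]
    rfl
  have hε : ∀ ε : ℝ, 0 < ε → ‖gradFunctional w (𝓕 K)‖ ≤
      traceConst d * ‖w‖ * √(ε * (∫ ξ, ‖θ ξ‖ ^ 2) + ∫ ξ, ‖ξ‖ * ‖θ ξ‖ ^ 2) := by
    intro ε hε
    -- Both functions have trace `𝓕 θ`, so the original may be traded for the low-energy extension.
    have h1 : gradFunctional w (𝓕 K) = gradFunctional w (𝓕 (extensionSchwartz hε hθ)) := by
      rw [← sub_eq_zero, ← map_sub]
      refine gradFunctional_eq_zero hw ?_
      rw [map_sub, boundaryTrace_fourier_extensionSchwartz, hFθ, sub_self]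
    rw [h1]
    refine (norm_gradFunctional_le _ _).trans ?_
    set A := ε * (∫ ξ, ‖θ ξ‖ ^ 2) + ∫ ξ, ‖ξ‖ * ‖θ ξ‖ ^ 2
    have hp : 0 ≤ ∫ t, profile t ^ 2 := integral_nonneg fun t => sq_nonneg _
    have h2 : ∀ i ∈ Finset.univ, ‖(partialDeriv i (𝓕 (extensionSchwartz hε hθ))).toLp 2‖ ≤
        √((2 * Real.pi) ^ 2 * (2 * ∫ t, profile t ^ 2)) * √A := by
      intro i _
      rw [← Real.sqrt_mul (by positivity), mul_assoc]
      exact Real.le_sqrt_of_sq_le (norm_partialDeriv_fourier_extensionSchwartz_sq_le hε hθ i)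
    refine (mul_le_mul_of_nonneg_left (Finset.sum_le_card_nsmul _ _ _ h2)
      (norm_nonneg w)).trans (le_of_eq ?_)
    simp only [Finset.card_univ, Fintype.card_fin, nsmul_eq_mul, traceConst]
    push_cast
    ring
  rw [hnorm]
  have hlim : Tendsto (fun ε : ℝ => traceConst d * ‖w‖ *
      √(ε * (∫ ξ, ‖θ ξ‖ ^ 2) + ∫ ξ, ‖ξ‖ * ‖θ ξ‖ ^ 2)) (𝓝[>] 0)
      (𝓝 (traceConst d * ‖w‖ * √(0 * (∫ ξ, ‖θ ξ‖ ^ 2) + ∫ ξ, ‖ξ‖ * ‖θ ξ‖ ^ 2))) :=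
    (Continuous.tendsto (by fun_prop) 0).mono_left nhdsWithin_le_nhds
  rw [zero_mul, zero_add] at hlim
  exact ge_of_tendsto hlim (eventually_mem_nhdsWithin.mono hε)

/-- The trace inequality in duality form. -/
theorem norm_gradFunctional_le_toFreqL2 {d : ℕ} {w : L2Field d} (hw : IsDivFree w)
    (φ : 𝓢(EuclideanSpace ℝ (Fin (d + 1)), ℂ)) :
    ‖gradFunctional w φ‖ ≤ traceConst d * ‖w‖ * ‖toFreqL2 d (boundaryTrace d φ)‖ := by
  -- The truncation is made in frequency, since the previous bound needs a compactly supported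
  -- Fourier side.
  obtain ⟨u, hu, -, hlim⟩ := SchwartzMap.exists_tendsto_hasCompactSupport (𝓕⁻ φ)
  have h : Tendsto (fun N => 𝓕 (u N)) atTop (𝓝 φ) := by
    have := ((fourierCLM ℂ 𝓢(EuclideanSpace ℝ (Fin (d + 1)), ℂ)).continuous.tendsto _).comp hlim
    rwa [fourierCLM_apply, FourierTransform.fourier_fourierInv_eq] at this
  have h1 := ((gradFunctional w).continuous.norm.tendsto φ).comp h
  have h2 := (((toFreqL2 d).continuous.comp (boundaryTrace d).continuous).norm.tendsto φ).comp h
  exact le_of_tendsto_of_tendsto' h1 (h2.const_mul (traceConst d * ‖w‖))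
    fun N => norm_gradFunctional_fourier_le hw (hu N)

/-! ### Duality and the representation of the trace -/

/-- A functional dominated by a linear map into a normed space factors through it with the same
bound. -/
theorem LinearMap.exists_strongDual_of_norm_le {V H : Type*} [AddCommGroup V] [Module ℂ V]
    [NormedAddCommGroup H] [NormedSpace ℂ H] (S : V →ₗ[ℂ] H) (T : V →ₗ[ℂ] ℂ) {C : ℝ} (hC : 0 ≤ C)
    (h : ∀ v, ‖T v‖ ≤ C * ‖S v‖) :
    ∃ ℓ : StrongDual ℂ H, ‖ℓ‖ ≤ C ∧ ∀ v, ℓ (S v) = T v := by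
  obtain ⟨r, hr⟩ := S.rangeRestrict.exists_rightInverse_of_surjective S.range_rangeRestrict
  have hr' : ∀ y, S (r y) = y := fun y => congrArg Subtype.val (LinearMap.congr_fun hr y)
  let f : StrongDual ℂ (LinearMap.range S) := (T ∘ₗ r).mkContinuous C fun y => by
    have := h (r y)
    rwa [hr'] at this
  obtain ⟨ℓ, hℓ, hn⟩ := exists_extension_norm_eq (LinearMap.range S) f
  refine ⟨ℓ, hn.trans_le (LinearMap.mkContinuous_norm_le _ hC _), fun v => ?_⟩
  have h1 : ℓ (S v) = T (r (S.rangeRestrict v)) := hℓ (S.rangeRestrict v)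
  -- The chosen preimage and `v` have the same image under `S`, so the bound forces `T` to agree on
  -- them.
  rw [h1, ← sub_eq_zero, ← map_sub, ← norm_le_zero_iff]
  refine (h _).trans (le_of_eq ?_)
  rw [map_sub, hr']
  simp

/-- The tempered distribution `f ↦ ℓ (𝓕⁻ f)`. -/
def dualDistribution {d : ℕ} (ℓ : StrongDual ℂ (Lp ℂ 2 (freqMeasure d))) :
    𝓢'(EuclideanSpace ℝ (Fin d), ℂ) :=
  ContinuousLinearMap.toPointwiseConvergenceCLM _ _ _ _ (ℓ ∘L toFreqL2 d)

theorem dualDistribution_apply {d : ℕ} (ℓ : StrongDual ℂ (Lp ℂ 2 (freqMeasure d)))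
    (f : 𝓢(EuclideanSpace ℝ (Fin d), ℂ)) : dualDistribution ℓ f = ℓ (toFreqL2 d f) := rfl

/-- The transforms `𝓕` and `𝓕⁻` cancel, leaving the inner product of `h` and `ψ` in `L²(|ξ| dξ)`;
the weight moves into the density and the inner product conjugates `h`. Local integrability comes
from `L²` for a locally finite measure. -/
theorem hasFourierDensity_dualDistribution {d : ℕ} (h : Lp ℂ 2 (freqMeasure d)) :
    HasFourierDensity (dualDistribution (InnerProductSpace.toDual ℂ _ h))
      (fun ξ => ‖ξ‖ • (starRingEnd ℂ) (h ξ)) := by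
  refine ⟨?_, fun ψ _ => ?_⟩
  · have hloc : LocallyIntegrable h (freqMeasure d) := (Lp.memLp h).locallyIntegrable one_le_two
    rw [locallyIntegrable_iff] at hloc ⊢
    intro k hk
    refine (Complex.conjCLE.toContinuousLinearMap.integrable_comp
      ((integrableOn_freqMeasure_iff hk.measurableSet).1 (hloc k hk))).congr
      (Eventually.of_forall fun ξ => ?_)
    simp
  · have h1 : (𝓕 (dualDistribution (InnerProductSpace.toDual ℂ _ h))) ψ =
        inner ℂ h (ψ.toLp 2 (freqMeasure d)) := by
      rw [TemperedDistribution.fourier_apply, dualDistribution_apply, toFreqL2_apply,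
        FourierTransform.fourierInv_fourier_eq]
      rfl
    rw [h1, L2.inner_def]
    have h2 : ∫ ξ, inner ℂ (h ξ) (ψ.toLp 2 (freqMeasure d) ξ) ∂freqMeasure d =
        ∫ ξ, inner ℂ (h ξ) (ψ ξ) ∂freqMeasure d := by
      refine integral_congr_ae ?_
      filter_upwards [ψ.coeFn_toLp 2 (freqMeasure d)] with ξ hξ
      rw [hξ]
    rw [h2, integral_freqMeasure]
    refine integral_congr_ae (Eventually.of_forall fun ξ => ?_)
    simp only [RCLike.inner_apply, Complex.real_smul]
    ring

/-- Pointwise, `|ξ|⁻¹ (|ξ| |h|)² = |ξ| |h|²`. -/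
theorem homSobolevENorm_dualDistribution_le {d : ℕ} (h : Lp ℂ 2 (freqMeasure d)) :
    homSobolevENorm (-1 / 2) (dualDistribution (InnerProductSpace.toDual ℂ _ h)) ≤ ‖h‖ₑ := by
  refine (iInf₂_le _ (hasFourierDensity_dualDistribution h)).trans ?_
  rw [Lp.enorm_def, eLpNorm_eq_lintegral_rpow_enorm_toReal two_ne_zero ENNReal.ofNat_ne_top,
    ENNReal.toReal_ofNat,
    lintegral_freqMeasure ((Lp.stronglyMeasurable h).enorm.pow_const (2 : ℝ))]
  refine ENNReal.rpow_le_rpow (lintegral_mono fun ξ => le_of_eq ?_) (by norm_num)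
  change ‖ξ‖ₑ ^ (2 * (-1 / 2 : ℝ)) * ‖‖ξ‖ • (starRingEnd ℂ) (h ξ)‖ₑ ^ 2 = ‖ξ‖ₑ * ‖h ξ‖ₑ ^ (2 : ℝ)
  rw [enorm_smul, enorm_norm, RCLike.enorm_conj, mul_pow, ENNReal.rpow_two]
  by_cases hξ : ξ = 0
  -- At `ξ = 0` the weight is `∞` but the density is zero, and `∞ * 0 = 0`.
  · simp [hξ]
  · rw [show (2 * (-1 / 2) : ℝ) = -1 by norm_num, ENNReal.rpow_neg_one, pow_two ‖ξ‖ₑ, ← mul_assoc,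
      ← mul_assoc, ENNReal.inv_mul_cancel (by simpa using hξ) enorm_ne_top, one_mul]

/-- The normal trace of a divergence-free field. -/
theorem exists_isNormalTrace {d : ℕ} {w : L2Field d} (hw : IsDivFree w) :
    ∃ g : 𝓢'(EuclideanSpace ℝ (Fin d), ℂ), IsNormalTrace w g ∧
      homSobolevENorm (-1 / 2) g ≤ ENNReal.ofReal (traceConst d * ‖w‖) := by
  have hC : 0 ≤ traceConst d * ‖w‖ := mul_nonneg (traceConst_nonneg d) (norm_nonneg w)
  obtain ⟨ℓ, hℓ, hfac⟩ := LinearMap.exists_strongDual_of_norm_le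
    ((toFreqL2 d).toLinearMap ∘ₗ (boundaryTrace d).toLinearMap) (gradFunctional w).toLinearMap hC
    (norm_gradFunctional_le_toFreqL2 hw)
  obtain ⟨h, rfl⟩ := (InnerProductSpace.toDual ℂ (Lp ℂ 2 (freqMeasure d))).surjective ℓ
  refine ⟨dualDistribution (InnerProductSpace.toDual ℂ _ h), fun φ ψ hψ => ?_, ?_⟩
  · have hφ : ContDiff ℝ ∞ φ := φ.contDiff
    let Φ : 𝓢(EuclideanSpace ℝ (Fin (d + 1)), ℂ) := φ.hasCompactSupport.toSchwartzMap hφ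
    have htr : ψ = boundaryTrace d Φ := by
      ext y
      exact hψ y
    rw [dualDistribution_apply, htr]
    exact (hfac Φ).trans (gradFunctional_apply w Φ)
  · refine (homSobolevENorm_dualDistribution_le h).trans ?_
    rw [← ofReal_norm]
    refine ENNReal.ofReal_le_ofReal ?_
    rwa [LinearIsometryEquiv.norm_map] at hℓ

end

theorem mainTheorem8 (d : ℕ) (hd : 2 ≤ d) :
    ∃ C : ℝ, 0 < C ∧ ∀ w : L2Field d, IsDivFree w →
      (∃! g : 𝓢'(EuclideanSpace ℝ (Fin d), ℂ), IsNormalTrace w g) ∧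
      ∀ g : 𝓢'(EuclideanSpace ℝ (Fin d), ℂ), IsNormalTrace w g →
        MemHomSobolev (-1 / 2) g ∧ homSobolevNorm (-1 / 2) g ≤ C * ‖w‖ := by
  -- Adding `1` makes the constant visibly positive.
  refine ⟨traceConst d + 1, by linarith [traceConst_nonneg d], fun w hw => ?_⟩
  obtain ⟨g, hg, hbound⟩ := exists_isNormalTrace hw
  refine ⟨⟨g, hg, fun g' hg' => hg'.unique hg⟩, fun g' hg' => ?_⟩
  rw [hg'.unique hg]
  refine ⟨hbound.trans_lt ENNReal.ofReal_lt_top, ?_⟩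
  refine (ENNReal.toReal_le_of_le_ofReal
    (mul_nonneg (traceConst_nonneg d) (norm_nonneg w)) hbound).trans ?_
  exact mul_le_mul_of_nonneg_right (by linarith) (norm_nonneg w)
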